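/- Let $\widetilde M$ be a complete simply connected $n$-dimensional Riemannian manifold whose sectional curvatures satisfy $-b^2\le k\le -1$ for some $b\ge 1$, let $d$ be its distance and $\partial_\infty\widetilde M$ its boundary at infinity (the classes of asymptotic geodesic rays, with the cone topology on $\widetilde M\cup\partial_\infty\widetilde M$). Fix $o\in\widetilde M$. For $\xi\in\partial_\infty\widetilde M$ let $\xi_t$ be the point at distance $t$ from $o$ on the geodesic ray $[o,\xi)$, and for $z\in\widetilde M\setminus\{o\}$ let $z^+\in\partial_\infty\widetilde M$ be the extremity of the geodesic ray starting at $o$ which contains $z$. Put $\langle w_1,w_2\rangle_o=\frac12\big(d(w_1,o)+d(o,w_2)-d(w_1,w_2)\big)$, $\langle\xi_1,\xi_2\rangle_o=\lim_{w_1\to\xi_1,\,w_2\to\xi_2}\langle w_1,w_2\rangle_o$, and let $\rho(\xi_1,\xi_2)=e^{-\langle\xi_1,\xi_2\rangle_o}$ if $\xi_1\ne\xi_2$, $\rho(\xi,\xi)=0$, be the visual distance on $\partial_\infty\widetilde M$; $\mathfrak B(\eta,r)=\{\xi:\rho(\eta,\xi)<r\}$ denotes its balls. Let $\Gamma$ be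 a discrete group of isometries of $\widetilde M$, let $\Lambda\subset\partial_\infty\widetilde M$ be its limit set (the boundary points in the closure of $\Gamma\cdot o$), and for $\alpha,\kappa>0$ put $$\Lambda^l(\alpha)=\Big\{\xi\in\Lambda:\liminf_{t\to\infty}\tfrac1t\,d(\xi_t,\Gamma\cdot o)>\alpha\Big\},$$ $$\Lambda^r(\kappa)=\bigcup_{c>0}\Big\{\xi\in\Lambda:\ \xi\in\mathfrak B\big((\gamma\cdot o)^+,\,c\,e^{-\frac1{1+\kappa}d(o,\gamma\cdot o)}\big)\text{ for infinitely many }\gamma\in\Gamma\text{ with }\gamma\cdot o\ne o\Big\}.$$ Let $0<\alpha<\beta<1/5$. Then for every $\xi\in\Lambda\setminus\Lambda^l(\alpha)$ there exist $c\ge1$ and a sequence $(\gamma_n)_n$ in $\Gamma$, with the points $\gamma_n\cdot o$ pairwise distinct and different from $o$, such that $$\xi\in\mathfrak B\Big((\gamma_n\cdot o)^+,\ c\,e^{-\frac{1-2\beta-\beta^2}{1-\beta^2}\,d(o,\gamma_n\cdot o)}\Big)\qquad\text{for every }n.$$ In particular, $\Lambda\setminus\Lambda^l(\alpha)\subset\Lambda^r\Big(\dfrac{2\beta}{1-2\beta-\beta^2}\Big)$.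 -/

import Mathlib

open Set Filter Topology Manifold Bundle
open scoped NNReal ENNReal ContDiff

noncomputable section

namespace KleinianLimit

/-! ### Sectional curvature of a Riemannian metric -/

section Curvature

variable {n : ℕ}

/-- Partial derivative `∂ᵢ f` of a function on `ℝⁿ`. -/
def partialD (i : Fin n) (f : EuclideanSpace ℝ (Fin n) → ℝ) (y : EuclideanSpace ℝ (Fin n)) : ℝ :=
  fderiv ℝ f y (EuclideanSpace.single i 1)

/-- Christoffel symbols
`Γᵏᵢⱼ = ½ ∑ₗ gᵏˡ (∂ᵢ gⱼₗ + ∂ⱼ gᵢₗ - ∂ₗ gᵢⱼ)` of a metric given by its matrix of coefficients. -/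
def christoffel (g : EuclideanSpace ℝ (Fin n) → Matrix (Fin n) (Fin n) ℝ) (k i j : Fin n)
    (y : EuclideanSpace ℝ (Fin n)) : ℝ :=
  (1 / 2) * ∑ l, (g y)⁻¹ k l *
    (partialD i (fun z => g z j l) y + partialD j (fun z => g z i l) y
      - partialD l (fun z => g z i j) y)

/-- Components of the Riemann tensor, `R(∂ᵢ, ∂ⱼ) ∂ₖ = ∑ₗ Rˡᵢⱼₖ ∂ₗ`, where
`R(X, Y) Z = ∇_X ∇_Y Z - ∇_Y ∇_X Z - ∇_[X,Y] Z`. -/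
def riemannTensor (g : EuclideanSpace ℝ (Fin n) → Matrix (Fin n) (Fin n) ℝ) (l i j k : Fin n)
    (y : EuclideanSpace ℝ (Fin n)) : ℝ :=
  partialD i (christoffel g l j k) y - partialD j (christoffel g l i k) y
    + ∑ m, (christoffel g m j k y * christoffel g l i m y
      - christoffel g m i k y * christoffel g l j m y)

/-- The value `g(u, v)` at `y` of the metric on two coordinate vectors. -/
def metricForm (g : EuclideanSpace ℝ (Fin n) → Matrix (Fin n) (Fin n) ℝ)
    (y u v : EuclideanSpace ℝ (Fin n)) : ℝ :=
  ∑ i, ∑ j, g y i j * u i * v j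

/-- Sectional curvature `g(R(u, v) v, u) / (g(u, u) g(v, v) - g(u, v)²)` at `y` of the plane
spanned by two linearly independent coordinate vectors `u`, `v`. -/
def sectionalCurvature (g : EuclideanSpace ℝ (Fin n) → Matrix (Fin n) (Fin n) ℝ)
    (y u v : EuclideanSpace ℝ (Fin n)) : ℝ :=
  (∑ i, ∑ j, ∑ k, ∑ l, ∑ m, g y l m * riemannTensor g l i j k y * u i * v j * v k * u m) /
    (metricForm g y u u * metricForm g y v v - metricForm g y u v ^ 2)

variable (M : Type*) [MetricSpace M] [ChartedSpace (EuclideanSpace ℝ (Fin n)) M]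
  [RiemannianBundle (fun x : M => TangentSpace 𝓘(ℝ, EuclideanSpace ℝ (Fin n)) x)]

/-- The coefficients `gᵢⱼ` of the Riemannian metric of `M` in the preferred chart `φ` at `p`: at a
point `y` of the target of `φ`, `gᵢⱼ(y)` is the inner product in `T_{φ⁻¹(y)} M` of the images of
the `i`-th and `j`-th basis vectors under the differential of `φ⁻¹`. -/
def metricCoeff (p : M) (y : EuclideanSpace ℝ (Fin n)) : Matrix (Fin n) (Fin n) ℝ :=
  Matrix.of fun i j =>
    inner ℝ
      (mfderiv 𝓘(ℝ, EuclideanSpace ℝ (Fin n)) 𝓘(ℝ, EuclideanSpace ℝ (Fin n))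
        (chartAt (EuclideanSpace ℝ (Fin n)) p).symm y (EuclideanSpace.single i 1 : EuclideanSpace ℝ (Fin n)) :
        TangentSpace 𝓘(ℝ, EuclideanSpace ℝ (Fin n)) ((chartAt (EuclideanSpace ℝ (Fin n)) p).symm y))
      (mfderiv 𝓘(ℝ, EuclideanSpace ℝ (Fin n)) 𝓘(ℝ, EuclideanSpace ℝ (Fin n))
        (chartAt (EuclideanSpace ℝ (Fin n)) p).symm y (EuclideanSpace.single j 1 : EuclideanSpace ℝ (Fin n)))

variable (n) in
/-- All sectional curvatures `k` of the Riemannian manifold `M` satisfy `-b² ≤ k ≤ -1`. At each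
point `p` they are computed in the preferred chart at `p`. -/
def PinchedCurvature (b : ℝ) : Prop :=
  ∀ (p : M) (u v : EuclideanSpace ℝ (Fin n)), LinearIndependent ℝ ![u, v] →
    sectionalCurvature (metricCoeff M p) (chartAt (EuclideanSpace ℝ (Fin n)) p p) u v
      ∈ Icc (-b ^ 2) (-1)

end Curvature

/-! ### The boundary at infinity -/

section Boundary

variable (M : Type*) [MetricSpace M]

/-- Unit speed geodesic rays `[0, ∞) → M`, that is, isometric embeddings of `[0, ∞)`. -/
def GeodesicRay : Type _ := {r : ℝ≥0 → M // Isometry r}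

/-- Two geodesic rays are asymptotic if they stay at bounded distance. -/
def asymptotic : Setoid (GeodesicRay M) where
  r r s := ∃ C : ℝ, ∀ t, dist (r.1 t) (s.1 t) ≤ C
  iseqv :=
    { refl := fun r => ⟨0, fun t => by simp⟩
      symm := fun ⟨C, h⟩ => ⟨C, fun t => by rw [dist_comm]; exact h t⟩
      trans := fun ⟨C, h⟩ ⟨D, k⟩ => ⟨C + D, fun t =>
        (dist_triangle _ _ _).trans (add_le_add (h t) (k t))⟩ }

/-- The boundary at infinity: classes of asymptotic geodesic rays. -/
def Boundary : Type _ := Quotient (asymptotic M)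

variable {M}

open Classical in
/-- The point `ξ_t` at distance `t` from `o` on the geodesic ray `[o, ξ)`, the ray of the class `ξ`
that starts at `o`. (There is exactly one such ray in a complete simply connected manifold of
nonpositive curvature; the value `o` is never used there.) -/
def Boundary.point (o : M) (ξ : Boundary M) (t : ℝ≥0) : M :=
  if h : ∃ r : GeodesicRay M, r.1 0 = o ∧ Quotient.mk (asymptotic M) r = ξ then h.choose.1 t else o

/-- The geodesic ray `[o, ξ)` as a set. -/
def rayTo (o : M) (ξ : Boundary M) : Set M := range (ξ.point o)

/-- The geodesic segment `[x, y]`. -/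
def geodSegment (x y : M) : Set M := {z | dist x z + dist z y = dist x y}

/-- The neighborhoods of `ξ` in the cone topology, traced on `M`: the filter generated by the sets
of those `w` at distance more than `T` from `o` such that the point of `[o, w]` at distance `T`
from `o` is `ε`-close to `ξ_T`. -/
def coneNhds (o : M) (ξ : Boundary M) : Filter M :=
  ⨅ (T : ℝ≥0) (ε : ℝ) (_ : 0 < ε),
    𝓟 {w | (T : ℝ) < dist o w ∧ ∃ x ∈ geodSegment o w, dist o x = T ∧ dist x (ξ.point o T) < ε}

/-- The Gromov product at `z` of two points of `M`. -/
def gromovProduct (z w₁ w₂ : M) : ℝ := (dist w₁ z + dist z w₂ - dist w₁ w₂) / 2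

/-- The Gromov product at `o` of two boundary points, the limit of `⟨w₁, w₂⟩_o` as `w₁ → ξ₁` and
`w₂ → ξ₂`. It is written as a lower limit, which is the limit whenever the limit exists
(as it does for curvature at most `-1`). -/
def boundaryGromovProduct (o : M) (ξ₁ ξ₂ : Boundary M) : EReal :=
  liminf (fun w : M × M => ((gromovProduct o w.1 w.2 : ℝ) : EReal))
    (coneNhds o ξ₁ ×ˢ coneNhds o ξ₂)

open Classical in
/-- The Gromov-Bourdon visual distance `ρ_o`. -/
def visualDist (o : M) (ξ₁ ξ₂ : Boundary M) : ℝ :=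
  if ξ₁ = ξ₂ then 0 else (EReal.exp (-boundaryGromovProduct o ξ₁ ξ₂)).toReal

/-- The visual ball `𝔅(η, r)`, seen from `o`. -/
def visualBall (o : M) (η : Boundary M) (r : ℝ) : Set (Boundary M) := {ξ | visualDist o η ξ < r}

/-- `η = z⁺`: `η` is the extremity of the geodesic ray from `o` which contains `z`. -/
def IsExtremity (o z : M) (η : Boundary M) : Prop := z ∈ rayTo o η

/-- The visual ball `𝔅(z⁺, r)` centered at the extremity `z⁺` of the geodesic ray from `o` which
contains `z ≠ o`. (In a complete simply connected manifold of nonpositive curvature there is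
exactly one `η` with `IsExtremity o z η`.) -/
def extremityBall (o z : M) (r : ℝ) : Set (Boundary M) :=
  {ξ | ∀ η, IsExtremity o z η → ξ ∈ visualBall o η r}

end Boundary

/-! ### Groups of isometries and their limit sets -/

section Groups

variable {M : Type*} [MetricSpace M]

/-- A Kleinian group: a group of isometries that is discrete in the compact-open topology. -/
def IsKleinian (Γ : Subgroup (M ≃ᵢ M)) : Prop :=
  DiscreteTopology ((fun γ : M ≃ᵢ M => (⟨γ, γ.continuous⟩ : C(M, M))) '' (Γ : Set (M ≃ᵢ M)))

/-- The orbit `Γ · o`. -/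
def orbit (Γ : Subgroup (M ≃ᵢ M)) (o : M) : Set M := range fun γ : Γ => (γ : M ≃ᵢ M) o

/-- The limit set `Λ`: the boundary points in the closure of `Γ · o` for the cone topology. -/
def limitSet (Γ : Subgroup (M ≃ᵢ M)) (o : M) : Set (Boundary M) :=
  {ξ | (coneNhds o ξ ⊓ 𝓟 (orbit Γ o)).NeBot}

/-- The `α`-linear escape limit set `Λˡ(α)`. -/
def linearEscapeLimitSet (Γ : Subgroup (M ≃ᵢ M)) (o : M) (α : ℝ) : Set (Boundary M) :=
  {ξ ∈ limitSet Γ o |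
    α < liminf (fun t : ℝ≥0 => (1 / (t : ℝ)) * Metric.infDist (ξ.point o t) (orbit Γ o)) atTop}

/-- The `κ`-weakly recurrent limit set `Λʳ(κ)`. -/
def weaklyRecurrentLimitSet (Γ : Subgroup (M ≃ᵢ M)) (o : M) (κ : ℝ) : Set (Boundary M) :=
  ⋃ c : {c : ℝ // 0 < c}, {ξ ∈ limitSet Γ o |
    {γ : Γ | (γ : M ≃ᵢ M) o ≠ o ∧
      ξ ∈ extremityBall o ((γ : M ≃ᵢ M) o)
        (c * Real.exp (-(1 / (1 + κ)) * dist o ((γ : M ≃ᵢ M) o)))}.Infinite}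

end Groups

end KleinianLimit

end

namespace KleinianLimit

section Boundary

variable {M : Type*} [MetricSpace M] {o : M}

/-! If `ξ` is not in `Λˡ(α)`, some orbit points `z` satisfy `d(ξ_t, z) ≤ β t` with `t` arbitrarily
large (`exists_orbit_dist_point_lt`). Then `d(o, z) ≤ (1 + β) t`, so `⟨z, ξ_t⟩_o ≥ (d(o, z) + (1 -
β) t) / 2 ≥ d(o, z) / (1 + β)`. Gromov products increase along rays from `o`, so the product of `z⁺`
and `ξ` is at least as large (`gromovProduct_point_le_boundaryGromovProduct`), whence `ρ(z⁺, ξ) ≤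
exp(-d(o, z) / (1 + β))`. This exponent beats the required one, so `c = 1` suffices. -/

theorem Boundary.isometry_point_of_ne {ξ : Boundary M} {T : ℝ≥0} (h : ξ.point o T ≠ o) :
    Isometry (ξ.point o) ∧ ξ.point o 0 = o := by
  by_cases hr : ∃ r : GeodesicRay M, r.1 0 = o ∧ Quotient.mk (asymptotic M) r = ξ
  · have key : ξ.point o = hr.choose.1 := by
      funext t
      simp only [Boundary.point, dif_pos hr]
    rw [key]
    exact ⟨hr.choose.2, hr.choose_spec.1⟩
  -- Without a ray from `o` in the class, `point` takes its default value `o`.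
  · exact absurd (by simp only [Boundary.point, dif_neg hr]) h

theorem Boundary.dist_point {ξ : Boundary M} (h : Isometry (ξ.point o) ∧ ξ.point o 0 = o)
    (t : ℝ≥0) : dist o (ξ.point o t) = t := by
  have h0 := h.1.dist_eq 0 t
  rw [h.2, NNReal.dist_eq] at h0
  simpa using h0

theorem mem_coneNhds (ξ : Boundary M) (T : ℝ≥0) {ε : ℝ} (hε : 0 < ε) :
    {w | (T : ℝ) < dist o w ∧ ∃ x ∈ geodSegment o w, dist o x = T ∧ dist x (ξ.point o T) < ε}
      ∈ coneNhds o ξ :=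
  mem_iInf_of_mem T (mem_iInf_of_mem ε (mem_iInf_of_mem hε (mem_principal_self _)))

/-- A boundary point whose cone neighborhoods are nonempty is reached by a ray from `o`. -/
theorem Boundary.isometry_point_of_neBot {ξ : Boundary M} (h : (coneNhds o ξ).NeBot) :
    Isometry (ξ.point o) ∧ ξ.point o 0 = o := by
  obtain ⟨w, -, x, -, hx, hd⟩ := h.nonempty_of_mem (mem_coneNhds ξ 1 one_pos)
  refine Boundary.isometry_point_of_ne (T := 1) fun h1 => ?_
  -- If `ξ_1` were the default `o`, then `x` would be both at distance `1` and at distance less than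
  -- `1` from `o`.
  rw [h1, dist_comm, hx] at hd
  simp at hd

/-- Moving from `xᵢ` out to `wᵢ` adds `d(x₁, w₁) + d(x₂, w₂)` to the distances from `o`, and at most
that to the distance between the two points. -/
theorem gromovProduct_le_of_mem_geodSegment {x₁ x₂ w₁ w₂ : M} (h₁ : x₁ ∈ geodSegment o w₁)
    (h₂ : x₂ ∈ geodSegment o w₂) : gromovProduct o x₁ x₂ ≤ gromovProduct o w₁ w₂ := by
  simp only [geodSegment, mem_ofPred_eq] at h₁ h₂
  have := dist_triangle4 w₁ x₁ x₂ w₂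
  simp only [gromovProduct, dist_comm x₁ o, dist_comm w₁ o]
  linarith [dist_comm w₁ x₁]

/-- The Gromov product of two points on rays from `o` is at most that of the extremities. -/
theorem gromovProduct_point_le_boundaryGromovProduct {η ξ : Boundary M}
    (hη : Isometry (η.point o) ∧ η.point o 0 = o) (hξ : Isometry (ξ.point o) ∧ ξ.point o 0 = o)
    (s t : ℝ≥0) :
    ((gromovProduct o (η.point o s) (ξ.point o t) : ℝ) : EReal)
      ≤ boundaryGromovProduct o η ξ := by
  refine le_of_forall_lt_imp_le_of_dense fun c hc => ?_
  obtain ⟨r, hcr, hr⟩ := EReal.lt_iff_exists_real_btwn.1 hc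
  rw [EReal.coe_lt_coe_iff] at hr
  refine hcr.le.trans (le_liminf_of_le (by isBoundedDefault) ?_)
  -- The gap to `r` serves as `ε`: as `x₁`, `x₂` lie at distances exactly `s`, `t` from `o`,
  -- replacing the ray points by them changes only `d(x₁, x₂)`, by less than `2 ε`, hence the
  -- product by less than `ε`.
  have hε := sub_pos.2 hr
  filter_upwards [prod_mem_prod (mem_coneNhds η s hε) (mem_coneNhds ξ t hε)]
  rintro ⟨w₁, w₂⟩ ⟨⟨-, x₁, hx₁, hs, hd₁⟩, ⟨-, x₂, hx₂, ht, hd₂⟩⟩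
  rw [EReal.coe_le_coe_iff]
  refine le_trans ?_ (gromovProduct_le_of_mem_geodSegment hx₁ hx₂)
  have h4 := dist_triangle4 x₁ (η.point o s) (ξ.point o t) x₂
  have e₁ := Boundary.dist_point hη s
  have e₂ := Boundary.dist_point hξ t
  rw [dist_comm x₂] at hd₂
  simp only [gromovProduct, dist_comm _ o] at hd₁ hd₂ ⊢
  rw [e₁, e₂] at hd₁ hd₂
  rw [hs, ht]
  linarith

theorem visualDist_le_exp_neg_gromovProduct {η ξ : Boundary M}
    (hη : Isometry (η.point o) ∧ η.point o 0 = o) (hξ : Isometry (ξ.point o) ∧ ξ.point o 0 = o)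
    (s t : ℝ≥0) :
    visualDist o η ξ ≤ Real.exp (-gromovProduct o (η.point o s) (ξ.point o t)) := by
  unfold visualDist
  split_ifs
  · positivity
  · refine ENNReal.toReal_le_of_le_ofReal (Real.exp_pos _).le ?_
    rw [← EReal.exp_coe, EReal.coe_neg]
    exact EReal.exp_monotone
      (EReal.neg_le_neg_iff.2 (gromovProduct_point_le_boundaryGromovProduct hη hξ s t))

end Boundary

section Groups

variable {M : Type*} [MetricSpace M] {o : M}

/-- A point `z` near `ξ_t`, up to an error `β t`, has `ξ` in a shadow of exponent `1 / (1 + β)`. -/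
theorem visualDist_le_of_dist_point_le {ξ η : Boundary M} {z : M} {t : ℝ≥0} {β : ℝ}
    (hξ : Isometry (ξ.point o) ∧ ξ.point o 0 = o) (hβ0 : 0 < β) (hβ1 : β < 1) (hz : z ≠ o)
    (hd : dist (ξ.point o t) z ≤ β * t) (hη : IsExtremity o z η) :
    visualDist o η ξ ≤ Real.exp (-(dist o z / (1 + β))) := by
  obtain ⟨s, rfl⟩ := hη
  have hη := Boundary.isometry_point_of_ne hz
  refine (visualDist_le_exp_neg_gromovProduct hη hξ s t).trans (Real.exp_le_exp.2 ?_)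
  rw [neg_le_neg_iff, div_le_iff₀ (by linarith)]
  have hub := dist_triangle o (ξ.point o t) (η.point o s)
  rw [Boundary.dist_point hξ t] at hub
  simp only [gromovProduct, dist_comm (η.point o s), Boundary.dist_point hξ t]
  nlinarith [dist_comm (ξ.point o t) (η.point o s)]

/-- Outside `Λˡ(α)`, the orbit comes `β t`-close to the ray `[o, ξ)` at points arbitrarily far
away, for each `β > α`. -/
theorem exists_orbit_dist_point_lt {Γ : Subgroup (M ≃ᵢ M)} {ξ : Boundary M} {α β : ℝ}
    (hξ : ξ ∈ limitSet Γ o \ linearEscapeLimitSet Γ o α)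
    (hξr : Isometry (ξ.point o) ∧ ξ.point o 0 = o) (hαβ : α < β) (hβ1 : β < 1) (R : ℝ) :
    ∃ γ : Γ, R < dist o ((γ : M ≃ᵢ M) o) ∧
      ∃ t : ℝ≥0, dist (ξ.point o t) ((γ : M ≃ᵢ M) o) ≤ β * t := by
  have hlim : liminf (fun t : ℝ≥0 =>
      (1 / (t : ℝ)) * Metric.infDist (ξ.point o t) (orbit Γ o)) atTop < β :=
    (not_lt.1 fun h => hξ.2 ⟨hξ.1, h⟩).trans_lt hαβ
  have ho : o ∈ orbit Γ o := ⟨1, rfl⟩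
  -- Since `o` is in the orbit, the quotient is bounded above, which the real `liminf` needs in
  -- order to yield frequent values below `β`.
  have hle : ∀ t : ℝ≥0, (1 / (t : ℝ)) * Metric.infDist (ξ.point o t) (orbit Γ o) ≤ 1 := by
    intro t
    have h := Metric.infDist_le_dist_of_mem (x := ξ.point o t) ho
    rw [dist_comm, Boundary.dist_point hξr] at h
    rw [one_div_mul_eq_div]
    exact div_le_one_of_le₀ h t.2
  have hfreq := frequently_lt_of_liminf_lt
    (isCoboundedUnder_ge_of_le atTop hle) hlim
  -- The threshold comes from `d(o, γ o) ≥ t - β t = (1 - β) t`, which must exceed `R`.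
  obtain ⟨t, ht, htR⟩ := (hfreq.and_eventually
    (eventually_gt_atTop (Real.toNNReal (R / (1 - β))))).exists
  have ht0 : (0 : ℝ) < t := NNReal.coe_pos.2 (pos_of_gt htR)
  rw [one_div_mul_eq_div, div_lt_iff₀ ht0, Metric.infDist_lt_iff ⟨o, ho⟩] at ht
  obtain ⟨-, ⟨γ, rfl⟩, hγ⟩ := ht
  refine ⟨γ, ?_, t, hγ.le⟩
  have h1 : R / (1 - β) < t := (Real.le_coe_toNNReal _).trans_lt (NNReal.coe_lt_coe.2 htR)
  rw [div_lt_iff₀ (by linarith)] at h1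
  have h2 := dist_triangle o ((γ : M ≃ᵢ M) o) (ξ.point o t)
  rw [Boundary.dist_point hξr, dist_comm _ (ξ.point o t)] at h2
  linarith

/-- Each term is chosen beyond the value of `f` at the previous one. With `f` the distance to `o`,
strict monotonicity makes the orbit points distinct. -/
theorem exists_seq_strictMono_of_forall_exists_lt {ι : Type*} {p : ι → Prop} {f : ι → ℝ}
    (h : ∀ R, ∃ i, R < f i ∧ p i) (R : ℝ) :
    ∃ u : ℕ → ι, StrictMono (f ∘ u) ∧ ∀ k, R < f (u k) ∧ p (u k) := by
  choose g hg hp using h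
  let u : ℕ → ι := fun k => Nat.rec (g R) (fun _ i => g (f i)) k
  have hu : StrictMono (f ∘ u) := strictMono_nat_of_lt_succ fun k => hg (f (u k))
  refine ⟨u, hu, fun k => ⟨(hg R).trans_le (hu.monotone (Nat.zero_le k)), ?_⟩⟩
  cases k with
  | zero => exact hp R
  | succ k => exact hp _

theorem exists_seq_mem_extremityBall {Γ : Subgroup (M ≃ᵢ M)} {ξ : Boundary M} {α β : ℝ}
    (hα : 0 < α) (hαβ : α < β) (hβ : β < 1 / 5)
    (hξ : ξ ∈ limitSet Γ o \ linearEscapeLimitSet Γ o α) :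
    ∃ c : ℝ, 1 ≤ c ∧ ∃ γ : ℕ → Γ,
      Function.Injective (fun k => (γ k : M ≃ᵢ M) o) ∧
      ∀ k, (γ k : M ≃ᵢ M) o ≠ o ∧
        ξ ∈ extremityBall o ((γ k : M ≃ᵢ M) o)
          (c * Real.exp (-((1 - 2 * β - β ^ 2) / (1 - β ^ 2)) * dist o ((γ k : M ≃ᵢ M) o))) := by
  have hβ0 : 0 < β := hα.trans hαβ
  have hξr : Isometry (ξ.point o) ∧ ξ.point o 0 = o :=
    Boundary.isometry_point_of_neBot (NeBot.mono hξ.1 inf_le_left)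
  obtain ⟨γ, hmono, hγ⟩ := exists_seq_strictMono_of_forall_exists_lt
    (fun R => exists_orbit_dist_point_lt hξ hξr hαβ (by linarith) R) 0
  refine ⟨1, le_rfl, γ, fun i j hij => hmono.injective (congrArg (dist o) hij), fun k => ?_⟩
  obtain ⟨hpos, t, ht⟩ := hγ k
  have hne : (γ k : M ≃ᵢ M) o ≠ o := (dist_pos.1 hpos).symm
  refine ⟨hne, fun η hη => ?_⟩
  refine (visualDist_le_of_dist_point_le hξr hβ0 (by linarith) hne ht hη).trans_lt ?_
  rw [one_mul, Real.exp_lt_exp, neg_mul, neg_lt_neg_iff, div_eq_inv_mul (dist _ _), ← one_div]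
  refine mul_lt_mul_of_pos_right ?_ hpos
  -- Since `1 - β² = (1 - β)(1 + β)`, the claim amounts to `1 - 2β - β² < 1 - β`.
  rw [div_lt_div_iff₀ (by nlinarith) (by linarith)]
  nlinarith [mul_pos hβ0 hβ0, mul_pos (mul_pos hβ0 hβ0) hβ0]

end Groups

end KleinianLimit

theorem proposition3p2 (n : ℕ) (M : Type*) [MetricSpace M]
    [ChartedSpace (EuclideanSpace ℝ (Fin n)) M]
    [IsManifold 𝓘(ℝ, EuclideanSpace ℝ (Fin n)) ∞ M]
    [RiemannianBundle (fun x : M => TangentSpace 𝓘(ℝ, EuclideanSpace ℝ (Fin n)) x)]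
    [IsContMDiffRiemannianBundle 𝓘(ℝ, EuclideanSpace ℝ (Fin n)) ∞ (EuclideanSpace ℝ (Fin n))
      (fun x : M => TangentSpace 𝓘(ℝ, EuclideanSpace ℝ (Fin n)) x)]
    [IsRiemannianManifold 𝓘(ℝ, EuclideanSpace ℝ (Fin n)) M]
    [CompleteSpace M] [SimplyConnectedSpace M]
    (b : ℝ) (hb : 1 ≤ b) (hM : KleinianLimit.PinchedCurvature n M b)
    (o : M) (Γ : Subgroup (M ≃ᵢ M)) (hΓ : KleinianLimit.IsKleinian Γ)
    (α β : ℝ) (hα : 0 < α) (hαβ : α < β) (hβ : β < 1 / 5) :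
    (∀ ξ ∈ KleinianLimit.limitSet Γ o \ KleinianLimit.linearEscapeLimitSet Γ o α,
      ∃ c : ℝ, 1 ≤ c ∧ ∃ γ : ℕ → Γ,
        Function.Injective (fun k => (γ k : M ≃ᵢ M) o) ∧
        ∀ k, (γ k : M ≃ᵢ M) o ≠ o ∧
          ξ ∈ KleinianLimit.extremityBall o ((γ k : M ≃ᵢ M) o)
            (c * Real.exp (-((1 - 2 * β - β ^ 2) / (1 - β ^ 2)) *
              dist o ((γ k : M ≃ᵢ M) o)))) ∧
    KleinianLimit.limitSet Γ o \ KleinianLimit.linearEscapeLimitSet Γ o α ⊆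
      KleinianLimit.weaklyRecurrentLimitSet Γ o (2 * β / (1 - 2 * β - β ^ 2)) := by
  have main := fun ξ hξ =>
    KleinianLimit.exists_seq_mem_extremityBall (Γ := Γ) (o := o) (ξ := ξ) hα hαβ hβ hξ
  refine ⟨main, fun ξ hξ => ?_⟩
  obtain ⟨c, hc, γ, hinj, hγ⟩ := main ξ hξ
  -- This `κ` is the one for which `1 / (1 + κ)` is the exponent of the first part.
  have hκ : 1 / (1 + 2 * β / (1 - 2 * β - β ^ 2)) = (1 - 2 * β - β ^ 2) / (1 - β ^ 2) := by
    have h1 : 1 - 2 * β - β ^ 2 ≠ 0 := by nlinarith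
    have h2 : 1 + 2 * β / (1 - 2 * β - β ^ 2) = (1 - β ^ 2) / (1 - 2 * β - β ^ 2) := by
      rw [eq_div_iff h1, add_mul, div_mul_cancel₀ _ h1]
      ring
    rw [h2, one_div_div]
  refine mem_iUnion.2 ⟨⟨c, by linarith⟩, hξ.1, ?_⟩
  refine infinite_of_injective_forall_mem (f := γ)
    (fun i j hij => hinj (congrArg (fun g : Γ => (g : M ≃ᵢ M) o) hij)) fun k => ?_
  rw [mem_ofPred_eq, hκ]
  exact hγ k
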